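/- Let $R$ be a commutative Noetherian ring and let $M$ be a finitely generated $R$-module of finite Krull dimension $\dim M=\dim\operatorname{Supp}M$. For a prime $\mathfrak p$ put $\operatorname{ht}_M\mathfrak p=\dim_{R_\mathfrak p}M_\mathfrak p$ (the zero module has dimension $-1$), and let $\operatorname{Min}M$ be the set of minimal elements of $\operatorname{Supp}M$. Let $\mathcal C_R(M)$ be the Cousin complex of $M$ with respect to the height filtration $H_i=\{\mathfrak p\in\operatorname{Supp}M:\operatorname{ht}_M\mathfrak p\ge i\}$, $i\geq 0$, i.e. the complex $$0\longrightarrow M\xrightarrow{d^{-1}}M^0\xrightarrow{d^0}M^1\longrightarrow\cdots,\qquad M^i=\bigoplus_{\mathfrak p\in H_i\setminus H_{i+1}}(\operatorname{Coker}d^{i-2})_\mathfrak p\quad(i\ge 0),$$ where $\operatorname{Coker}d^{-2}=M$ and the component of $d^{i-1}(y)$ at $\mathfrak p$ is $\pi(y)/1$, with $\pi$ the projection $M^{i-1}\to\operatorname{Coker}d^{i-2}$ (and $M^{-1}=M$). Let $\mathcal H^i_M=\operatorname{Ker}d^i/\operatorname{Im}d^{i-1}$, $i\ge -1$, be its cohomology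 modules, and assume that each $\mathcal H^i_M$ is a finitely generated $R$-module. Then $M$ has a uniform local cohomological annihilator, that is, there is an element $x\in R\setminus\bigcup_{\mathfrak p\in\operatorname{Min}M}\mathfrak p$ such that $x\,H^i_{\mathfrak m}(M)=0$ for every maximal ideal $\mathfrak m$ of $R$ and every $0\le i<\operatorname{ht}_M\mathfrak m$. Moreover, if $M\ne 0$ and $d=\dim M$, then for every $x\in R\setminus\bigcup_{\mathfrak p\in\operatorname{Min}M}\mathfrak p$ that annihilates $\mathcal H^i_M$ for all $i\ge -1$, the element $x^d$ is a uniform local cohomological annihilator of $M$. -/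

import Mathlib

open scoped DirectSum

universe u

namespace CousinComplexes

/-! ### Heights relative to a module -/

section Height

variable {R : Type u} [CommRing R]

/-- The `M`-height of a prime `p`: the Krull dimension of the `R_p`-module `M_p`
(it is `⊥` when `M_p = 0`, which plays the role of dimension `-1`). -/
noncomputable def moduleHeight (M : Type u) [AddCommGroup M] [Module R M] (p : PrimeSpectrum R) :
    WithBot ℕ∞ :=
  Module.supportDim (Localization.AtPrime p.asIdeal) (LocalizedModule p.asIdeal.primeCompl M)

/-- The minimal primes of a module: the minimal members of its support. -/
def minPrimes (R : Type u) [CommRing R] (M : Type u) [AddCommGroup M] [Module R M] :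
    Set (PrimeSpectrum R) :=
  {p | Minimal (fun q => q ∈ Module.support R M) p}

variable (M : Type u) [AddCommGroup M] [Module R M]

lemma mem_support_localized_iff (p : PrimeSpectrum R)
    (P : PrimeSpectrum (Localization.AtPrime p.asIdeal)) :
    P ∈ Module.support (Localization.AtPrime p.asIdeal) (LocalizedModule p.asIdeal.primeCompl M) ↔
      PrimeSpectrum.comap (algebraMap R (Localization.AtPrime p.asIdeal)) P ∈
        Module.support R M := by
  rw [← not_iff_not, Module.notMem_support_iff', Module.notMem_support_iff']
  constructor
  · intro h m
    obtain ⟨r, hr, hrm⟩ := h (LocalizedModule.mkLinearMap p.asIdeal.primeCompl M m)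
    obtain ⟨⟨a, s⟩, rfl⟩ := IsLocalization.mk'_surjective p.asIdeal.primeCompl r
    have h1 : algebraMap R (Localization.AtPrime p.asIdeal) a ∉ P.asIdeal := by
      rw [← IsLocalization.mk'_spec (Localization.AtPrime p.asIdeal) a s]
      intro hmem
      rcases P.2.mem_or_mem hmem with h | h
      · exact hr h
      · exact P.2.ne_top (Ideal.eq_top_of_isUnit_mem _ h (IsLocalization.map_units _ s))
    have h2 : LocalizedModule.mkLinearMap p.asIdeal.primeCompl M (a • m) = 0 := by
      rw [map_smul, ← algebraMap_smul (Localization.AtPrime p.asIdeal) a,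
        ← IsLocalization.mk'_spec' (Localization.AtPrime p.asIdeal) a s, mul_smul]
      exact (congrArg _ hrm).trans (smul_zero _)
    obtain ⟨t, ht⟩ := (IsLocalizedModule.eq_zero_iff p.asIdeal.primeCompl _).1 h2
    refine ⟨t * a, ?_, by rw [mul_smul]; exact ht⟩
    intro hmem
    have hmem' : algebraMap R (Localization.AtPrime p.asIdeal) (t * a) ∈ P.asIdeal := hmem
    rw [map_mul] at hmem'
    rcases P.2.mem_or_mem hmem' with h | h
    · exact P.2.ne_top (Ideal.eq_top_of_isUnit_mem _ h (IsLocalization.map_units _ t))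
    · exact h1 h
  · intro h y
    obtain ⟨⟨m, s⟩, hy⟩ := IsLocalizedModule.surj p.asIdeal.primeCompl
      (LocalizedModule.mkLinearMap p.asIdeal.primeCompl M) y
    obtain ⟨r, hr, hrm⟩ := h m
    refine ⟨algebraMap R (Localization.AtPrime p.asIdeal) (r * s), ?_, ?_⟩
    · rw [map_mul]
      intro hmem
      rcases P.2.mem_or_mem hmem with h | h
      · exact hr h
      · exact P.2.ne_top (Ideal.eq_top_of_isUnit_mem _ h (IsLocalization.map_units _ s))
    · rw [algebraMap_smul, mul_smul]
      have : (s : R) • y = LocalizedModule.mkLinearMap p.asIdeal.primeCompl M m := hy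
      rw [this, ← map_smul, hrm, map_zero]

/-- On the support of `M`, the `M`-height of `p` is the supremum of the lengths of the chains of
primes of the support that end in `p`. -/
lemma moduleHeight_eq_height {p : PrimeSpectrum R} (hp : p ∈ Module.support R M) :
    moduleHeight M p = (Order.height (⟨p, hp⟩ : Module.support R M) : WithBot ℕ∞) := by
  rw [Order.height_eq_krullDim_Iic, moduleHeight, Module.supportDim]
  let e := IsLocalization.AtPrime.primeSpectrumOrderIso (Localization.AtPrime p.asIdeal) p.asIdeal
  have he : ∀ P, ((e P : PrimeSpectrum R)) =
      PrimeSpectrum.comap (algebraMap R (Localization.AtPrime p.asIdeal)) P := fun P => rfl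
  apply le_antisymm
  · refine Order.krullDim_le_of_strictMono
      (fun P => ⟨⟨e P.1, (he P.1).symm ▸ (mem_support_localized_iff M p P.1).1 P.2⟩, (e P.1).2⟩) ?_
    intro P Q hPQ
    exact e.strictMono hPQ
  · refine Order.krullDim_le_of_strictMono
      (fun q => ⟨e.symm ⟨q.1.1, q.2⟩, (mem_support_localized_iff M p _).2 ?_⟩) ?_
    · rw [← he, OrderIso.apply_symm_apply]
      exact q.1.2
    · intro q q' hqq'
      exact e.symm.strictMono hqq'

lemma moduleHeight_add_one_le {p q : PrimeSpectrum R} (hq : q ∈ Module.support R M) (h : q < p) :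
    moduleHeight M q + 1 ≤ moduleHeight M p := by
  have hp := Module.mem_support_mono h.le hq
  rw [moduleHeight_eq_height M hp, moduleHeight_eq_height M hq]
  have : Order.height (⟨q, hq⟩ : Module.support R M) + 1 ≤
      Order.height (⟨p, hp⟩ : Module.support R M) := Order.height_add_one_le h
  exact_mod_cast this

end Height

/-! ### Filtrations of the spectrum -/

/-- A filtration of `Spec R`: a descending sequence `F 0 ⊇ F 1 ⊇ ⋯` of sets of primes such that
every member of `F i \ F (i + 1)` is a minimal member of `F i`. -/
structure SpecFiltration (R : Type u) [CommRing R] where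
  /-- The terms of the filtration. -/
  F : ℕ → Set (PrimeSpectrum R)
  succ_subset : ∀ i, F (i + 1) ⊆ F i
  minimal : ∀ i, ∀ p ∈ F i \ F (i + 1), Minimal (fun q => q ∈ F i) p

/-- `∂F i = F i \ F (i + 1)`. -/
def SpecFiltration.boundary {R : Type u} [CommRing R] (𝓕 : SpecFiltration R) (i : ℕ) :
    Set (PrimeSpectrum R) :=
  𝓕.F i \ 𝓕.F (i + 1)

/-- The filtration admits `M` when `Supp M ⊆ F 0`. -/
def SpecFiltration.Admits {R : Type u} [CommRing R] (𝓕 : SpecFiltration R)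
    (M : Type u) [AddCommGroup M] [Module R M] : Prop :=
  Module.support R M ⊆ 𝓕.F 0

/-- The height filtration of `M`: its `i`-th term is `{p ∈ Supp M | ht_M p ≥ i}`. -/
def heightFiltration (R : Type u) [CommRing R] (M : Type u) [AddCommGroup M] [Module R M] :
    SpecFiltration R where
  F i := {p | p ∈ Module.support R M ∧ (i : WithBot ℕ∞) ≤ moduleHeight M p}
  succ_subset i p hp := ⟨hp.1, le_trans (by exact_mod_cast Nat.le_succ i) hp.2⟩
  minimal i p hp := by
    refine ⟨hp.1, fun q hq hqp => ?_⟩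
    by_contra hpq
    refine hp.2 ⟨hp.1.1, le_trans ?_ (moduleHeight_add_one_le M hq.1 (lt_of_le_not_ge hqp hpq))⟩
    rw [Nat.cast_add, Nat.cast_one]
    exact add_le_add_left hq.2 1

lemma heightFiltration_admits (R : Type u) [CommRing R] (M : Type u) [AddCommGroup M]
    [Module R M] : (heightFiltration R M).Admits M := by
  intro p hp
  refine ⟨hp, ?_⟩
  rw [moduleHeight_eq_height M hp]
  exact_mod_cast (zero_le : 0 ≤ Order.height (⟨p, hp⟩ : Module.support R M))

/-! ### The Cousin complex -/

/-- If `N` is supported in `F i`, then away from `F (i + 1)` an element of `⨁_{q ∈ ∂F i} N_q` is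
killed, outside its `p`-component, by an element not in `p`. -/
lemma exists_smul_apply_eq_zero {R : Type u} [CommRing R] (𝓕 : SpecFiltration R)
    {N : Type u} [AddCommGroup N] [Module R N] {i : ℕ}
    (hN : Module.support R N ⊆ 𝓕.F i) {p : PrimeSpectrum R} (hp : p ∉ 𝓕.F (i + 1))
    (w : ⨁ q : 𝓕.boundary i, LocalizedModule q.1.asIdeal.primeCompl N) :
    ∃ r ∉ p.asIdeal, ∀ q : 𝓕.boundary i, q.1 ≠ p → r • w q = 0 := by
  classical
  induction w using DirectSum.induction_on with
  | zero => exact ⟨1, p.2.one_notMem, fun q _ => by simp⟩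
  | add x y hx hy =>
    obtain ⟨r, hr, hrx⟩ := hx
    obtain ⟨s, hs, hsy⟩ := hy
    refine ⟨r * s, fun h => (p.2.mem_or_mem h).elim hr hs, fun q hq => ?_⟩
    rw [DirectSum.add_apply, smul_add, mul_smul r s (y q), hsy q hq, mul_comm r s, mul_smul,
      hrx q hq, smul_zero, smul_zero, add_zero]
  | of q z =>
    by_cases hqp : q.1 = p
    · refine ⟨1, p.2.one_notMem, fun q' hq' => ?_⟩
      rw [DirectSum.of_eq_of_ne _ _ _ (fun h => hq' (by rw [h, hqp])), smul_zero]
    · obtain ⟨⟨c, s⟩, hz⟩ := IsLocalizedModule.mk'_surjective q.1.asIdeal.primeCompl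
        (LocalizedModule.mkLinearMap q.1.asIdeal.primeCompl N) z
      have key : ∃ r ∉ p.asIdeal, ∃ t ∉ q.1.asIdeal, t • r • c = 0 := by
        by_contra hcon
        push Not at hcon
        have hdisj : Disjoint ((Submodule.span R {c}).annihilator : Set R)
            (p.asIdeal.primeCompl ⊔ q.1.asIdeal.primeCompl : Submonoid R) := by
          rw [Set.disjoint_left]
          intro a ha ha'
          obtain ⟨r, hr, t, ht, rfl⟩ := Submonoid.mem_sup.1 ha'
          refine hcon r hr t ht ?_
          rw [smul_smul, mul_comm]
          exact (Submodule.mem_annihilator_span_singleton _ _).1 ha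
        obtain ⟨Q, hQ, hle, hQd⟩ := Ideal.exists_le_prime_disjoint _ _ hdisj
        have hQp : Q ≤ p.asIdeal := fun a ha => by
          by_contra h
          exact Set.disjoint_left.1 hQd ha (Submonoid.mem_sup_left h)
        have hQq : Q ≤ q.1.asIdeal := fun a ha => by
          by_contra h
          exact Set.disjoint_left.1 hQd ha (Submonoid.mem_sup_right h)
        have hQF : (⟨Q, hQ⟩ : PrimeSpectrum R) ∈ 𝓕.F i :=
          hN (Module.mem_support_iff_exists_annihilator.2 ⟨c, hle⟩)
        have hpF : p ∈ 𝓕.F i :=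
          hN (Module.mem_support_iff_exists_annihilator.2 ⟨c, hle.trans hQp⟩)
        have h1 : q.1 ≤ p :=
          le_trans ((𝓕.minimal i q.1 q.2).2 hQF hQq) hQp
        exact hqp (le_antisymm h1 ((𝓕.minimal i p ⟨hpF, hp⟩).2 q.2.1 h1))
      obtain ⟨r, hr, t, ht, hrt⟩ := key
      refine ⟨r, hr, fun q' hq' => ?_⟩
      by_cases hqq : q' = q
      · subst hqq
        rw [DirectSum.of_eq_same, ← hz, Function.uncurry_apply_pair, ← IsLocalizedModule.mk'_smul,
          IsLocalizedModule.mk'_eq_zero']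
        exact ⟨⟨t, ht⟩, hrt⟩
      · rw [DirectSum.of_eq_of_ne _ _ _ hqq, smul_zero]

section Cousin

variable {R : Type u} [CommRing R] [IsNoetherianRing R] (𝓕 : SpecFiltration R)

/-- An element of a module supported in `F i` has non-zero image in the localization at only
finitely many primes of `∂F i`. -/
lemma finite_localization_ne_zero {N : Type u} [AddCommGroup N] [Module R N] {i : ℕ}
    (hN : Module.support R N ⊆ 𝓕.F i) (x : N) :
    {p : 𝓕.boundary i |
      LocalizedModule.mkLinearMap p.1.asIdeal.primeCompl N x ≠ 0}.Finite := by
  have hfin := (Submodule.span R {x}).annihilator.finite_minimalPrimes_of_isNoetherianRing R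
  refine Set.Finite.of_finite_image (f := fun p : 𝓕.boundary i => p.1.asIdeal)
    (hfin.subset ?_) ?_
  · rintro _ ⟨p, hp, rfl⟩
    have hle : (Submodule.span R {x}).annihilator ≤ p.1.asIdeal := by
      intro r hr
      by_contra hrp
      refine hp ((IsLocalizedModule.eq_zero_iff p.1.asIdeal.primeCompl _).2 ⟨⟨r, hrp⟩, ?_⟩)
      exact (Submodule.mem_annihilator_span_singleton _ _).1 hr
    refine ⟨⟨p.1.2, hle⟩, fun Q hQ hQp => ?_⟩
    have hQF : (⟨Q, hQ.1⟩ : PrimeSpectrum R) ∈ 𝓕.F i :=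
      hN (Module.mem_support_iff_exists_annihilator.2 ⟨x, hQ.2⟩)
    exact (𝓕.minimal i p.1 p.2).2 hQF hQp
  · intro p _ q _ h
    exact Subtype.ext (PrimeSpectrum.ext h)

open Classical in
/-- For `x` in a module `N` supported in `F i`, the element of `⨁_{p ∈ ∂F i} N_p` whose component
at `p` is `x / 1`. -/
noncomputable def localizationFamily {N : Type u} [AddCommGroup N] [Module R N] {i : ℕ}
    (hN : Module.support R N ⊆ 𝓕.F i) (x : N) :
    ⨁ p : 𝓕.boundary i, LocalizedModule p.1.asIdeal.primeCompl N :=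
  DFinsupp.mk (finite_localization_ne_zero 𝓕 hN x).toFinset
    fun p => LocalizedModule.mkLinearMap p.1.1.asIdeal.primeCompl N x

lemma localizationFamily_apply {N : Type u} [AddCommGroup N] [Module R N] {i : ℕ}
    (hN : Module.support R N ⊆ 𝓕.F i) (x : N) (p : 𝓕.boundary i) :
    localizationFamily 𝓕 hN x p = LocalizedModule.mkLinearMap p.1.asIdeal.primeCompl N x := by
  classical
  refine DFinsupp.mk_apply.trans ?_
  split_ifs with h
  · rfl
  · by_contra h0
    exact h ((Set.Finite.mem_toFinset _).2 (Ne.symm h0))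

/-- For a module `N` supported in `F i`, the map `N → ⨁_{p ∈ ∂F i} N_p` with components
`x ↦ x / 1`. -/
noncomputable def toLocalizations {N : Type u} [AddCommGroup N] [Module R N] {i : ℕ}
    (hN : Module.support R N ⊆ 𝓕.F i) :
    N →ₗ[R] ⨁ p : 𝓕.boundary i, LocalizedModule p.1.asIdeal.primeCompl N where
  toFun := localizationFamily 𝓕 hN
  map_add' x y := by
    refine DFinsupp.ext fun p => ?_
    rw [DirectSum.add_apply]
    simp only [localizationFamily_apply, map_add]
  map_smul' r x := by
    refine DFinsupp.ext fun p => ?_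
    rw [RingHom.id_apply, DirectSum.smul_apply]
    simp only [localizationFamily_apply, map_smul]

lemma toLocalizations_apply {N : Type u} [AddCommGroup N] [Module R N] {i : ℕ}
    (hN : Module.support R N ⊆ 𝓕.F i) (x : N) (p : 𝓕.boundary i) :
    toLocalizations 𝓕 hN x p = LocalizedModule.mkLinearMap p.1.asIdeal.primeCompl N x :=
  localizationFamily_apply 𝓕 hN x p

/-- The cokernel of `N → ⨁_{p ∈ ∂F i} N_p` is supported in `F (i + 1)`. -/
lemma support_quotient_range_subset {N : Type u} [AddCommGroup N] [Module R N] {i : ℕ}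
    (hN : Module.support R N ⊆ 𝓕.F i) :
    Module.support R ((⨁ p : 𝓕.boundary i, LocalizedModule p.1.asIdeal.primeCompl N) ⧸
      LinearMap.range (toLocalizations 𝓕 hN)) ⊆ 𝓕.F (i + 1) := by
  intro p hps
  by_contra hp
  refine Module.notMem_support_iff'.2 (fun m => ?_) hps
  obtain ⟨w, rfl⟩ := Submodule.mkQ_surjective _ m
  obtain ⟨r, hr, hrw⟩ := exists_smul_apply_eq_zero 𝓕 hN hp w
  suffices h : ∃ s ∉ p.asIdeal, s • w ∈ LinearMap.range (toLocalizations 𝓕 hN) by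
    obtain ⟨s, hs, hsw⟩ := h
    exact ⟨s, hs, by rw [← map_smul]; exact (Submodule.Quotient.mk_eq_zero _).2 hsw⟩
  by_cases hpi : p ∈ 𝓕.boundary i
  · obtain ⟨⟨c, s⟩, hz⟩ := IsLocalizedModule.surj p.asIdeal.primeCompl
      (LocalizedModule.mkLinearMap p.asIdeal.primeCompl N) (w ⟨p, hpi⟩)
    obtain ⟨r', hr', hrw'⟩ := exists_smul_apply_eq_zero 𝓕 hN hp (toLocalizations 𝓕 hN c)
    refine ⟨r' * s * r, ?_, r' • r • c, DFinsupp.ext fun q => ?_⟩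
    · intro h
      rcases p.2.mem_or_mem h with h | h
      · exact (p.2.mem_or_mem h).elim hr' s.2
      · exact hr h
    · rw [map_smul, map_smul]
      simp only [DirectSum.smul_apply]
      by_cases hq : q.1 = p
      · obtain rfl : q = ⟨p, hpi⟩ := Subtype.ext hq
        have hz' : (s : R) • w ⟨p, hpi⟩ = LocalizedModule.mkLinearMap p.asIdeal.primeCompl N c := hz
        rw [toLocalizations_apply, ← hz', smul_smul, smul_smul]
        congr 1
        ring
      · rw [mul_smul, hrw q hq, smul_zero, smul_comm, hrw' q hq, smul_zero]
  · refine ⟨r, hr, 0, DFinsupp.ext fun q => ?_⟩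
    rw [map_zero, DirectSum.smul_apply, hrw q (fun h => hpi (h ▸ q.2))]
    rfl

/-- The data from which the Cousin complex is continued: a module `T` (the current term) and a
submodule `D` of `T` (the image of the incoming differential), with `T ⧸ D` supported in `F i`. -/
structure Stage (i : ℕ) where
  /-- The current term of the complex. -/
  T : Type u
  [addCommGroup : AddCommGroup T]
  [module : Module R T]
  /-- The image of the incoming differential. -/
  D : Submodule R T
  support_subset : Module.support R (T ⧸ D) ⊆ 𝓕.F i

attribute [instance] Stage.addCommGroup Stage.module

namespace Stage

variable {𝓕} {i : ℕ} (S : Stage 𝓕 i)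

/-- The next term of the complex, `⨁_{p ∈ ∂F i} (T ⧸ D)_p`. -/
abbrev NextTerm : Type u :=
  ⨁ p : 𝓕.boundary i, LocalizedModule p.1.asIdeal.primeCompl (S.T ⧸ S.D)

/-- The outgoing differential `T → ⨁_{p ∈ ∂F i} (T ⧸ D)_p`: the component at `p` of the image of
`x` is `π x / 1`, where `π : T → T ⧸ D` is the projection. -/
noncomputable def d : S.T →ₗ[R] S.NextTerm :=
  toLocalizations 𝓕 S.support_subset ∘ₗ S.D.mkQ

lemma d_apply (x : S.T) (p : 𝓕.boundary i) :
    S.d x p = LocalizedModule.mkLinearMap p.1.asIdeal.primeCompl (S.T ⧸ S.D) (S.D.mkQ x) :=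
  toLocalizations_apply 𝓕 S.support_subset _ p

/-- The next stage: its term is `⨁_{p ∈ ∂F i} (T ⧸ D)_p`, its submodule the image of `d`. -/
noncomputable def next : Stage 𝓕 (i + 1) where
  T := S.NextTerm
  D := LinearMap.range S.d
  support_subset := by
    have h : LinearMap.range S.d = LinearMap.range (toLocalizations 𝓕 S.support_subset) := by
      rw [d, LinearMap.range_comp, Submodule.range_mkQ, LinearMap.range_eq_map]
    rw [h]
    exact support_quotient_range_subset 𝓕 S.support_subset

end Stage

variable {𝓕} in
/-- The stages of the Cousin complex of `M` with respect to a filtration that admits `M`. It starts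
from the term `M` with incoming image `0` (so `M ⧸ ⊥` is `Coker (0 → M)`). -/
noncomputable def cousinStage (M : Type u) [AddCommGroup M] [Module R M] (h𝓕 : 𝓕.Admits M) :
    (n : ℕ) → Stage 𝓕 n
  | 0 =>
    { T := M
      D := ⊥
      support_subset := fun _ hp => h𝓕
        (Module.support_subset_of_surjective (Submodule.mkQ ⊥) (Submodule.mkQ_surjective ⊥) hp) }
  | n + 1 => (cousinStage M h𝓕 n).next

variable {𝓕} in
/-- The terms of the Cousin complex `0 → M → M⁰ → M¹ → ⋯` of `M` with respect to `𝓕`, numbered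
from `0`: the term of index `0` is `M` (usually placed in degree `-1`), and the term of index
`n + 1` is `Mⁿ = ⨁_{p ∈ ∂F n} (Coker dⁿ⁻²)_p`. -/
abbrev CousinTerm (M : Type u) [AddCommGroup M] [Module R M] (h𝓕 : 𝓕.Admits M) (n : ℕ) : Type u :=
  (cousinStage M h𝓕 n).T

variable {𝓕} in
/-- The differentials of the Cousin complex: the one of index `n` is `dⁿ⁻¹ : Mⁿ⁻¹ → Mⁿ`. -/
noncomputable def cousinD (M : Type u) [AddCommGroup M] [Module R M] (h𝓕 : 𝓕.Admits M) (n : ℕ) :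
    CousinTerm M h𝓕 n →ₗ[R] CousinTerm M h𝓕 (n + 1) :=
  (cousinStage M h𝓕 n).d

variable {𝓕} in
lemma cousinStage_succ_D (M : Type u) [AddCommGroup M] [Module R M] (h𝓕 : 𝓕.Admits M) (n : ℕ) :
    (cousinStage M h𝓕 (n + 1)).D = LinearMap.range (cousinD M h𝓕 n) :=
  rfl

variable {𝓕} in
lemma cousinD_comp_cousinD (M : Type u) [AddCommGroup M] [Module R M] (h𝓕 : 𝓕.Admits M) (n : ℕ) :
    cousinD M h𝓕 (n + 1) ∘ₗ cousinD M h𝓕 n = 0 := by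
  refine LinearMap.ext fun x => ?_
  have h : (cousinStage M h𝓕 (n + 1)).D.mkQ (cousinD M h𝓕 n x) = 0 :=
    (Submodule.Quotient.mk_eq_zero _).2 ⟨x, rfl⟩
  exact (congrArg (toLocalizations 𝓕 (cousinStage M h𝓕 (n + 1)).support_subset) h).trans
    (map_zero _)

variable {𝓕} in
/-- The cohomology modules of the Cousin complex: kernel of the outgoing differential modulo the
image of the incoming one. The one of index `n` is `Hⁿ⁻¹ = Ker dⁿ⁻¹ / Im dⁿ⁻²`, so that index `0`
is the kernel of `M → M⁰`. -/
abbrev CousinCohomology (M : Type u) [AddCommGroup M] [Module R M] (h𝓕 : 𝓕.Admits M) (n : ℕ) :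
    Type u :=
  LinearMap.ker (cousinD M h𝓕 n) ⧸
    (cousinStage M h𝓕 n).D.submoduleOf (LinearMap.ker (cousinD M h𝓕 n))

/-- The cohomology modules `H_M^i`, `i ≥ -1`, of the Cousin complex of `M` with respect to its
height filtration; index `n` stands for `i = n - 1`. -/
abbrev HeightCousinCohomology (R : Type u) [CommRing R] [IsNoetherianRing R] (M : Type u)
    [AddCommGroup M] [Module R M] (n : ℕ) : Type u :=
  CousinCohomology M (heightFiltration_admits R M) n

/-- The Cousin complex of `M` (for the height filtration) is finite: all its cohomology modules
are finitely generated. -/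
def IsCousinFinite (R : Type u) [CommRing R] [IsNoetherianRing R] (M : Type u)
    [AddCommGroup M] [Module R M] : Prop :=
  ∀ n : ℕ, Module.Finite R (HeightCousinCohomology R M n)

end Cousin

/-! ### Uniform local cohomological annihilators -/

/-- `x` is a uniform local cohomological annihilator of `M`: it lies in no minimal prime of `M`,
and it annihilates `H^i_𝔪(M)` for every maximal ideal `𝔪` and all `i < ht_M 𝔪`. -/
def IsUniformLocalCohomologicalAnnihilator {R : Type u} [CommRing R] (M : Type u)
    [AddCommGroup M] [Module R M] (x : R) : Prop :=
  (∀ p ∈ minPrimes R M, x ∉ p.asIdeal) ∧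
    ∀ (m : PrimeSpectrum R), m.asIdeal.IsMaximal → ∀ i : ℕ, (i : WithBot ℕ∞) < moduleHeight M m →
      ∀ h : (localCohomology m.asIdeal i).obj (ModuleCat.of R M), x • h = 0

end CousinComplexes

/-! Write `Tₙ` for the terms of the Cousin complex, `Dₙ` for the incoming image, `Kₙ` for the kernel
and `Hₙ = Kₙ / Dₙ`. The complex splits into the sequences `0 → Kₙ → Tₙ → Dₙ₊₁ → 0` and `0 → Dₙ → Kₙ
→ Hₙ → 0`. If a maximal ideal `m` lies in `F (n + 1)`, every summand of `Tₙ₊₁` is a localization at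
a prime not containing `m`, so some element of `m` acts invertibly on it and `Tₙ₊₁` has no local
cohomology at `m`. The long exact sequences then express degree `i + 1` of `Dₙ₊₁` through degree `i`
of `Dₙ₊₂`, at the cost of one factor `x` for `Hₙ₊₁` (`annihilatesLimitExt_cousinStage_D`). Since `M`
is an extension of `D₁` by `H₀`, `x ^ (i + 1)` kills degree `i` whenever `i + 1 ≤ ht_M m ≤ d`.

Such an `x` exists because `Hₙ` is supported at primes of height at least `n + 1`: its annihilator
lies in no minimal prime of `M`, and only finitely many `Hₙ` are nonzero, so prime avoidance
applies.

Local cohomology is the colimit of the derived-functor `Ext R _ i` of `R ⧸ J ^ k`, while the long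
exact sequences are those of `Abelian.Ext`. Everything is therefore proved for the predicate
`AnnihilatesLimitExt` and transferred once, through cocycles, by
`AnnihilatesLimitExt.smul_localCohomology_eq_zero`. -/

namespace CousinComplexes

open CategoryTheory Opposite Abelian

/-! ### Cocycle representatives, the link between the two constructions of Ext. -/

section ExtCocycle

variable {R : Type u} [CommRing R] {X Y : ModuleCat.{u} R} (P : ProjectiveResolution X) (n : ℕ)

/-- The image of a projective resolution of `X` under `Hom(-, Y)`, as a chain complex in the
opposite of the category of modules. -/
noncomputable abbrev homComplex (Y : ModuleCat.{u} R) : ChainComplex (ModuleCat.{u} R)ᵒᵖ ℕ :=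
  (((linearYoneda R (ModuleCat.{u} R)).obj Y).rightOp.mapHomologicalComplex _).obj P.complex

/-- The isomorphism from the cohomology of `Hom(P, Y)` to `Ext R (ModuleCat R) n X Y`. -/
noncomputable def homologyToExt (Y : ModuleCat.{u} R) : ((homComplex P Y).homology n).unop ⟶
    ((Ext R (ModuleCat.{u} R) n).obj (op X)).obj Y :=
  (P.isoLeftDerivedObj ((linearYoneda R (ModuleCat.{u} R)).obj Y).rightOp n).hom.unop

instance : IsIso (homologyToExt P n Y) :=
  inferInstanceAs (IsIso
    (P.isoLeftDerivedObj ((linearYoneda R (ModuleCat.{u} R)).obj Y).rightOp n).hom.unop)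

/-- The class in `Ext R (ModuleCat R) n` of a cochain, given as a relation: `f : Pₙ ⟶ Y` is a
cocycle with class `z`. -/
def RepresentsExt (z : ((Ext R (ModuleCat.{u} R) n).obj (op X)).obj Y)
    (f : P.complex.X n ⟶ Y) : Prop :=
  ∃ w : ((homComplex P Y).opcycles n).unop,
    homologyToExt P n Y (((homComplex P Y).homologyι n).unop w) = z ∧
    ((homComplex P Y).pOpcycles n).unop w = f

variable {n}

lemma exists_representsExt (z : ((Ext R (ModuleCat.{u} R) n).obj (op X)).obj Y) :
    ∃ f, RepresentsExt P n z f := by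
  have h : Function.Surjective ⇑(((homComplex P Y).homologyι n).unop ≫
      homologyToExt P n Y) :=
    (ModuleCat.epi_iff_surjective _).1 inferInstance
  obtain ⟨w, hw⟩ := h z
  exact ⟨_, w, hw, rfl⟩

variable {P}

lemma RepresentsExt.smul {z : ((Ext R (ModuleCat.{u} R) n).obj (op X)).obj Y}
    {f : P.complex.X n ⟶ Y} (h : RepresentsExt P n z f) (r : R) :
    RepresentsExt P n (r • z) (r • f) := by
  obtain ⟨w, rfl, rfl⟩ := h
  exact ⟨r • w, by simp only [map_smul], by simp only [map_smul]; rfl⟩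

lemma RepresentsExt.d_comp {z : ((Ext R (ModuleCat.{u} R) n).obj (op X)).obj Y}
    {f : P.complex.X n ⟶ Y} (h : RepresentsExt P n z f) (m : ℕ) :
    P.complex.d m n ≫ f = 0 := by
  obtain ⟨w, -, rfl⟩ := h
  have h1 := congrArg Quiver.Hom.unop ((homComplex P Y).d_pOpcycles m n)
  exact ConcreteCategory.congr_hom h1 w

lemma RepresentsExt.map {X' : ModuleCat.{u} R} {P' : ProjectiveResolution X'} {g : X' ⟶ X}
    (φ : ProjectiveResolution.Hom P' P g) {z : ((Ext R (ModuleCat.{u} R) n).obj (op X)).obj Y}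
    {f : P.complex.X n ⟶ Y} (h : RepresentsExt P n z f) :
    RepresentsExt P' n (((Ext R (ModuleCat.{u} R) n).map g.op).app Y z) (φ.hom.f n ≫ f) := by
  obtain ⟨w, rfl, rfl⟩ := h
  let F := ((linearYoneda R (ModuleCat.{u} R)).obj Y).rightOp
  let ψ : homComplex P' Y ⟶ homComplex P Y := (F.mapHomologicalComplex _).map φ.hom
  refine ⟨(HomologicalComplex.opcyclesMap ψ n).unop w, ?_, ?_⟩
  · have h1 := congrArg Quiver.Hom.unop (HomologicalComplex.homologyι_naturality ψ n)
    have h2 := congrArg Quiver.Hom.unop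
      (ProjectiveResolution.isoLeftDerivedObj_hom_naturality g P' P φ.hom
        (by simpa using φ.hom_f_zero_comp_π_f_zero) F n)
    have h3 := ConcreteCategory.congr_hom h1 w
    have h4 := ConcreteCategory.congr_hom h2 (((homComplex P Y).homologyι n).unop w)
    refine Eq.trans ?_ h4.symm
    exact congrArg (homologyToExt P' n Y) h3.symm
  · have h1 := congrArg Quiver.Hom.unop (HomologicalComplex.p_opcyclesMap ψ n)
    exact ConcreteCategory.congr_hom h1 w

/-- Coboundaries have class zero. No relation between `m` and `n` is needed, since `d n m` is zero
unless the indices are adjacent. -/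
lemma RepresentsExt.eq_zero {z : ((Ext R (ModuleCat.{u} R) n).obj (op X)).obj Y} {m : ℕ}
    {g : P.complex.X m ⟶ Y} (h : RepresentsExt P n z (P.complex.d n m ≫ g)) : z = 0 := by
  obtain ⟨w, rfl, hw⟩ := h
  have h1 := congrArg Quiver.Hom.unop ((homComplex P Y).p_fromOpcycles n m)
  have h2 := ConcreteCategory.congr_hom h1 g
  have h3 : Function.Injective ⇑((homComplex P Y).pOpcycles n).unop :=
    (ModuleCat.mono_iff_injective _).1 inferInstance
  have h4 : w = ((homComplex P Y).fromOpcycles n m).unop g := h3 (hw.trans h2.symm)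
  have h5 := congrArg Quiver.Hom.unop ((homComplex P Y).homologyι_comp_fromOpcycles n m)
  have h6 := ConcreteCategory.congr_hom h5 g
  rw [h4]
  exact (congrArg _ h6).trans (map_zero _)

lemma extMk_eq_zero_iff' (f : P.complex.X n ⟶ Y) (m : ℕ) (hm : n + 1 = m)
    (hf : P.complex.d m n ≫ f = 0) (h : P.extMk f m hm hf = 0) :
    ∃ (p : ℕ) (g : P.complex.X p ⟶ Y), P.complex.d n p ≫ g = f := by
  cases n with
  | succ p => exact ⟨p, (P.extMk_eq_zero_iff f m hm hf p rfl).1 h⟩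
  | zero =>
    -- In degree 0 there are no nonzero coboundaries, so the claim is `f = 0`; the resolution has no
    -- term in cohomological degree 1.
    refine ⟨0, 0, ?_⟩
    simp only [← P.extEquivCohomologyClass.apply_eq_iff_eq,
      ProjectiveResolution.extEquivCohomologyClass_extMk,
      ProjectiveResolution.extEquivCohomologyClass_zero,
      CochainComplex.HomComplex.CohomologyClass.mk_eq_zero_iff] at h
    rw [CochainComplex.HomComplex.Cocycle.toSingleMk_mem_coboundaries_iff _ _ _ _ _ 1
      (by simp)] at h
    obtain ⟨g, hg⟩ := h
    have h0 : P.cochainComplex.d (-((0 : ℕ) : ℤ)) 1 = 0 :=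
      (P.cochainComplex.isZero_of_isStrictlyLE 0 1 (by simp)).eq_of_tgt _ _
    rw [h0, Limits.zero_comp] at hg
    rw [Limits.comp_zero, ← cancel_epi (P.cochainComplexXIso (-((0 : ℕ) : ℤ)) 0 rfl).hom, ← hg,
      Limits.comp_zero]

end ExtCocycle
end CousinComplexes

namespace CousinComplexes

open CategoryTheory Opposite Abelian

/-! ### Annihilators of the direct limit of `Ext^i(R ⧸ J ^ k, N)`. -/

section LocalExt

variable {R : Type u} [CommRing R]

/-- The projection `R ⧸ J ^ l ⟶ R ⧸ J ^ k` for `k ≤ l`. -/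
abbrev powProj (J : Ideal R) {k l : ℕ} (h : k ≤ l) :
    ModuleCat.of R (R ⧸ J ^ l) ⟶ ModuleCat.of R (R ⧸ J ^ k) :=
  ModuleCat.ofHom (Submodule.mapQ _ _ LinearMap.id (Ideal.pow_le_pow_right h))

lemma powProj_comp (J : Ideal R) {k l l' : ℕ} (h : k ≤ l) (h' : l ≤ l') :
    powProj J h' ≫ powProj J h = powProj J (h.trans h') := by
  refine ModuleCat.hom_ext (LinearMap.ext fun x => ?_)
  obtain ⟨x, rfl⟩ := Submodule.mkQ_surjective _ x
  rfl

/-- `y` annihilates the direct limit of the modules `Ext^i(R ⧸ J ^ k, N)`: the multiple by `y` of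
every class becomes zero at a later stage. -/
def AnnihilatesLimitExt (J : Ideal R) (i : ℕ) (N : ModuleCat.{u} R) (y : R) : Prop :=
  ∀ (k : ℕ) (c : Ext.{u} (ModuleCat.of R (R ⧸ J ^ k)) N i), ∃ (l : ℕ) (h : k ≤ l),
    y • (Ext.mk₀ (powProj J h)).comp c (zero_add i) = 0

theorem AnnihilatesLimitExt.smul_localCohomology_eq_zero {J : Ideal R} {i : ℕ}
    {N : ModuleCat.{u} R} {y : R} (H : AnnihilatesLimitExt J i N y)
    (h : (localCohomology J i).obj N) : y • h = 0 := by
  have hcol := Limits.isColimitOfPreserves ((evaluation _ _).obj N)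
    (Limits.colimit.isColimit (localCohomology.diagram (localCohomology.idealPowersDiagram J) i))
  let F := localCohomology.diagram (localCohomology.idealPowersDiagram J) i
  let ι : ∀ k : ℕ, ((Ext R (ModuleCat.{u} R) i).obj (op (ModuleCat.of R (R ⧸ J ^ k)))).obj N ⟶
      (localCohomology J i).obj N := fun k => (Limits.colimit.ι F (op (op k))).app N
  have : Limits.PreservesFilteredColimitsOfSize.{0, 0} (forget (ModuleCat.{u} R)) :=
    Limits.preservesFilteredColimitsOfSize_shrink.{0, u, 0, u} _
  -- The colimit is filtered, so `h` comes from a class at a finite stage `k`; its cocycle `f` also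
  -- defines a class in `Abelian.Ext`.
  obtain ⟨⟨⟨k⟩⟩, c, hc⟩ := Limits.Concrete.isColimit_exists_rep _ hcol h
  let P := fun k : ℕ => projectiveResolution (ModuleCat.of R (R ⧸ J ^ k))
  obtain ⟨f, hf⟩ := exists_representsExt (P k) c
  obtain ⟨l, hkl, hl⟩ := H k ((P k).extMk f (i + 1) rfl (hf.d_comp _))
  let φ : ProjectiveResolution.Hom (P l) (P k) (powProj J hkl) :=
    ⟨ProjectiveResolution.lift (powProj J hkl) (P l) (P k),
      ProjectiveResolution.lift_commutes_zero _ _ _⟩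
  rw [ProjectiveResolution.mk₀_comp_extMk f _ rfl _ φ, Ext.smul_eq_comp_mk₀,
    ProjectiveResolution.extMk_comp_mk₀] at hl
  -- Vanishing in `Abelian.Ext` makes the cocycle itself a coboundary, hence its derived-functor
  -- class vanishes too.
  obtain ⟨p, g, hg⟩ := extMk_eq_zero_iff' _ _ _ _ hl
  have hrep := (hf.map φ).smul y
  have heq : y • (φ.hom.f i ≫ f) = (P l).complex.d i p ≫ g := by
    rw [hg, Linear.comp_smul, Category.comp_id]
  rw [heq] at hrep
  have h0 := hrep.eq_zero
  have hw : F.map (homOfLE hkl).op.op ≫ Limits.colimit.ι F (op (op l)) =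
      Limits.colimit.ι F (op (op k)) := Limits.colimit.w F _
  have hw' := ConcreteCategory.congr_hom (congrArg (fun t => t.app N) hw) c
  rw [← hc]
  change y • ι k c = 0
  have h1 : ι k c = ι l (((Ext R (ModuleCat.{u} R) i).map (powProj J hkl).op).app N c) := hw'.symm
  rw [h1]
  exact (map_smul (ι l).hom y _).symm.trans ((congrArg (ι l) h0).trans (map_zero (ι l).hom))

variable {J : Ideal R} {i : ℕ} {y z : R}

lemma AnnihilatesLimitExt.dvd {N : ModuleCat.{u} R} (h : AnnihilatesLimitExt J i N y)
    (hyz : y ∣ z) : AnnihilatesLimitExt J i N z := by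
  obtain ⟨w, rfl⟩ := hyz
  intro k c
  obtain ⟨l, hl, h0⟩ := h k c
  exact ⟨l, hl, by rw [mul_comm, mul_smul, h0, smul_zero]⟩

lemma annihilatesLimitExt_of_forall_smul_eq_zero (J : Ideal R) (i : ℕ) {N : ModuleCat.{u} R}
    (h : ∀ a : N, y • a = 0) : AnnihilatesLimitExt J i N y := by
  intro k c
  refine ⟨k, le_rfl, ?_⟩
  have h0 : y • 𝟙 N = 0 := by
    ext a
    exact h a
  rw [Ext.smul_eq_comp_mk₀, h0, Ext.mk₀_zero, Ext.comp_zero]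

lemma smul_mk₀_powProj_comp {N : ModuleCat.{u} R} {k l l' : ℕ} (h : k ≤ l) (h' : l ≤ l')
    (c : Ext.{u} (ModuleCat.of R (R ⧸ J ^ k)) N i) :
    (Ext.mk₀ (powProj J h')).comp (z • (Ext.mk₀ (powProj J h)).comp c (zero_add i)) (zero_add i) =
      z • (Ext.mk₀ (powProj J (h.trans h'))).comp c (zero_add i) := by
  rw [Ext.comp_smul, Ext.mk₀_comp_mk₀_assoc, powProj_comp]

/-- At a later stage `z` kills the image in `X₃`, so `z • c` lifts to `X₁`; at a still later stage
`y` kills the lift. -/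
lemma AnnihilatesLimitExt.X₂ {S : ShortComplex (ModuleCat.{u} R)} (hS : S.ShortExact)
    (h₁ : AnnihilatesLimitExt J i S.X₁ y) (h₃ : AnnihilatesLimitExt J i S.X₃ z) :
    AnnihilatesLimitExt J i S.X₂ (y * z) := by
  intro k c
  obtain ⟨l, hl, h0⟩ := h₃ k (c.comp (Ext.mk₀ S.g) (add_zero i))
  rw [← Ext.comp_assoc_of_third_deg_zero, ← Ext.smul_comp] at h0
  obtain ⟨c₁, hc₁⟩ := Ext.covariant_sequence_exact₂ _ hS _ h0
  obtain ⟨l', hl', h0'⟩ := h₁ l c₁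
  refine ⟨l', hl.trans hl', ?_⟩
  rw [mul_smul, ← smul_mk₀_powProj_comp hl hl', ← hc₁, ← Ext.comp_assoc_of_third_deg_zero,
    ← Ext.smul_comp, h0', Ext.zero_comp]

/-- Same argument one step along the long exact sequence: `z • c` is the connecting image of a class
of `X₃`. -/
lemma AnnihilatesLimitExt.X₁_succ {S : ShortComplex (ModuleCat.{u} R)} (hS : S.ShortExact)
    (h₃ : AnnihilatesLimitExt J i S.X₃ y) (h₂ : AnnihilatesLimitExt J (i + 1) S.X₂ z) :
    AnnihilatesLimitExt J (i + 1) S.X₁ (y * z) := by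
  intro k c
  obtain ⟨l, hl, h0⟩ := h₂ k (c.comp (Ext.mk₀ S.f) (add_zero _))
  rw [← Ext.comp_assoc_of_third_deg_zero, ← Ext.smul_comp] at h0
  obtain ⟨c₃, hc₃⟩ := Ext.covariant_sequence_exact₁ _ hS _ h0 rfl
  obtain ⟨l', hl', h0'⟩ := h₃ l c₃
  refine ⟨l', hl.trans hl', ?_⟩
  rw [mul_smul, ← smul_mk₀_powProj_comp hl hl', ← hc₃,
    ← Ext.comp_assoc _ _ _ (zero_add i) rfl (by lia), ← Ext.smul_comp, h0', Ext.zero_comp]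

lemma AnnihilatesLimitExt.of_mono {N N' : ModuleCat.{u} R} (f : N ⟶ N') [Mono f]
    (h : AnnihilatesLimitExt J 0 N' z) : AnnihilatesLimitExt J 0 N z := by
  intro k c
  obtain ⟨l, hl, h0⟩ := h k (c.comp (Ext.mk₀ f) (add_zero _))
  rw [← Ext.comp_assoc_of_third_deg_zero, ← Ext.smul_comp] at h0
  exact ⟨l, hl, Ext.postcomp_mk₀_injective_of_mono _ f (h0.trans (map_zero _).symm)⟩

end LocalExt
end CousinComplexes

namespace CousinComplexes

open CategoryTheory Opposite Abelian

/-! ### Vanishing for direct sums of modules on which elements of `J` are invertible. -/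

section DirectSumExt

variable {R : Type u} [CommRing R]

/-- Multiplication by `a` on Ext is zero when computed on `X` and invertible when computed on `N`.
-/
lemma ext_eq_zero_of_isUnit {X N : ModuleCat.{u} R} {i : ℕ} {a : R} (hX : ∀ x : X, a • x = 0)
    (hN : IsUnit (algebraMap R (Module.End R N) a)) (c : Ext.{u} X N i) : c = 0 := by
  obtain ⟨v, hv⟩ := hN.exists_right_inv
  have h1 : a • 𝟙 X = 0 := by
    ext x
    exact hX x
  have h2 : (ModuleCat.ofHom v : N ⟶ N) ≫ (a • 𝟙 N) = 𝟙 N :=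
    ModuleCat.hom_ext hv
  have h3 : a • c = 0 := by
    rw [← Ext.mk₀_id_comp c, ← Ext.smul_comp, ← Ext.mk₀_smul, h1, Ext.mk₀_zero, Ext.zero_comp]
  rw [← Ext.comp_mk₀_id c, ← h2, Linear.comp_smul, Ext.mk₀_smul, Ext.comp_smul, ← Ext.smul_comp, h3,
    Ext.zero_comp]

variable (R) {I : Type u} (N : I → Type u) [∀ j, AddCommGroup (N j)] [∀ j, Module R (N j)]

open Classical in
/-- The projection of a direct sum to the summand of index `j`, as an endomorphism. -/
noncomputable abbrev summandProj (j : I) :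
    ModuleCat.of R (⨁ j, N j) ⟶ ModuleCat.of R (⨁ j, N j) :=
  ModuleCat.ofHom (DirectSum.component R I N j) ≫ ModuleCat.ofHom (DirectSum.lof R I N j)

variable {R} [IsNoetherianRing R]

/-- A class in `Ext^i(X, ⨁ N_j)`, with `X` finitely generated, comes from finitely many
summands. -/
lemma exists_comp_sum_summandProj_eq (i : ℕ) (X : ModuleCat.{u} R) [Module.Finite R X]
    (c : Ext.{u} X (ModuleCat.of R (⨁ j, N j)) i) :
    ∃ S : Finset I, c.comp (Ext.mk₀ (∑ j ∈ S, summandProj R N j)) (add_zero i) = c := by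
  classical
  induction i generalizing X with
  | zero =>
    obtain ⟨f, rfl⟩ := Ext.homEquiv₀.symm.surjective c
    obtain ⟨G, hG⟩ := Module.Finite.fg_top (R := R) (M := X)
    -- The images of finitely many generators involve finitely many coordinates.
    refine ⟨G.biUnion fun x => DFinsupp.support (f x), ?_⟩
    rw [Ext.homEquiv₀_symm_apply, Ext.mk₀_comp_mk₀]
    congr 1
    refine ModuleCat.hom_ext (LinearMap.ext_on hG fun x hx => ?_)
    have h1 : (f ≫ ∑ j ∈ G.biUnion fun x => DFinsupp.support (f x), summandProj R N j) x =
        ∑ j ∈ G.biUnion fun x => DFinsupp.support (f x), DirectSum.of N j (f x j) := by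
      refine (DFunLike.congr_fun (map_sum (ModuleCat.homAddEquiv (M := ModuleCat.of R (⨁ j, N j))
        (N := ModuleCat.of R (⨁ j, N j))) (summandProj R N) _) (f x)).trans ?_
      rw [LinearMap.sum_apply]
      rfl
    refine h1.trans ?_
    rw [← Finset.sum_subset (Finset.subset_biUnion_of_mem (fun x => DFinsupp.support (f x)) hx)]
    · exact DirectSum.sum_support_of _
    · intro j _ hj
      rw [DFinsupp.notMem_support_iff.1 hj, map_zero]
  | succ i ih =>
    -- Dimension shifting: `c` is a connecting image from the kernel of a finite free cover, which
    -- is finitely generated because `R` is Noetherian.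
    obtain ⟨n, g, hg⟩ := Module.Finite.exists_fin' R X
    have hS := LinearMap.shortExact_shortComplexKer hg
    obtain ⟨c', rfl⟩ := Ext.contravariant_sequence_exact₃ hS _ c
      (Ext.eq_zero_of_projective _) (add_comm 1 i)
    have : Module.Finite R (LinearMap.shortComplexKer g).X₁ :=
      inferInstanceAs (Module.Finite R (LinearMap.ker g))
    obtain ⟨S, hS'⟩ := ih (LinearMap.shortComplexKer g).X₁ c'
    refine ⟨S, ?_⟩
    rw [Ext.comp_assoc_of_third_deg_zero, hS']

/-- A module `⨁ N_j` such that on each `N_j` some element of `J` acts invertibly has no local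
cohomology with support in `J`. -/
lemma annihilatesLimitExt_directSum (J : Ideal R) (i : ℕ) (y : R)
    (h : ∀ j, ∃ a ∈ J, IsUnit (algebraMap R (Module.End R (N j)) a)) :
    AnnihilatesLimitExt J i (ModuleCat.of R (⨁ j, N j)) y := by
  intro k c
  refine ⟨k, le_rfl, ?_⟩
  suffices hc : c = 0 by rw [hc, Ext.comp_zero, smul_zero]
  have : Module.Finite R (ModuleCat.of R (R ⧸ J ^ k)) :=
    inferInstanceAs (Module.Finite R (R ⧸ J ^ k))
  obtain ⟨S, hS⟩ := exists_comp_sum_summandProj_eq N i _ c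
  have h0 : Ext.mk₀ (∑ j ∈ S, summandProj R N j) = ∑ j ∈ S, Ext.mk₀ (summandProj R N j) :=
    map_sum Ext.addEquiv₀.symm _ _
  rw [← hS, h0, ← Ext.bilinearComp_apply_apply, map_sum]
  refine Finset.sum_eq_zero fun j _ => ?_
  obtain ⟨a, ha, hu⟩ := h j
  rw [Ext.bilinearComp_apply_apply, ← Ext.mk₀_comp_mk₀, ← Ext.comp_assoc_of_third_deg_zero]
  -- The class factors through `Ext(R ⧸ J ^ k, N j)`, where `a ^ k` kills the first argument and is
  -- invertible on the second.
  rw [ext_eq_zero_of_isUnit (a := a ^ k) (fun x => ?_) ?_ (c.comp _ _), Ext.zero_comp]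
  · rw [map_pow]
    exact hu.pow k
  · obtain ⟨x, rfl⟩ := Ideal.Quotient.mk_surjective x
    exact Ideal.Quotient.eq_zero_iff_mem.2 (Ideal.mul_mem_right _ _ (Ideal.pow_mem_pow ha k))

end DirectSumExt
end CousinComplexes

namespace CousinComplexes

open CategoryTheory Opposite Abelian

/-! ### The exact-sequence lemmas for linear maps. -/

section Exact

lemma _root_.LinearMap.exact_subtype_ker_rangeRestrict {R A B : Type*} [CommRing R]
    [AddCommGroup A] [AddCommGroup B] [Module R A] [Module R B] (f : A →ₗ[R] B) :
    Function.Exact (LinearMap.ker f).subtype f.rangeRestrict := by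
  rw [LinearMap.exact_iff, LinearMap.ker_rangeRestrict, Submodule.range_subtype]

variable {R : Type u} [CommRing R] {A B C : Type u} [AddCommGroup A] [AddCommGroup B]
  [AddCommGroup C] [Module R A] [Module R B] [Module R C] {f : A →ₗ[R] B} {g : B →ₗ[R] C}
  {J : Ideal R} {i : ℕ} {y z : R}

lemma AnnihilatesLimitExt.middle (hf : Function.Injective f) (hfg : Function.Exact f g)
    (hg : Function.Surjective g) (h₁ : AnnihilatesLimitExt J i (ModuleCat.of R A) y)
    (h₃ : AnnihilatesLimitExt J i (ModuleCat.of R C) z) :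
    AnnihilatesLimitExt J i (ModuleCat.of R B) (y * z) :=
  AnnihilatesLimitExt.X₂ (S := ModuleCat.shortComplexOfCompEqZero f g hfg.linearMap_comp_eq_zero)
    (ModuleCat.shortComplex_shortExact _ hfg hf hg) h₁ h₃

lemma AnnihilatesLimitExt.left_succ (hf : Function.Injective f) (hfg : Function.Exact f g)
    (hg : Function.Surjective g) (h₃ : AnnihilatesLimitExt J i (ModuleCat.of R C) y)
    (h₂ : AnnihilatesLimitExt J (i + 1) (ModuleCat.of R B) z) :
    AnnihilatesLimitExt J (i + 1) (ModuleCat.of R A) (y * z) :=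
  AnnihilatesLimitExt.X₁_succ
    (S := ModuleCat.shortComplexOfCompEqZero f g hfg.linearMap_comp_eq_zero)
    (ModuleCat.shortComplex_shortExact _ hfg hf hg) h₃ h₂

end Exact

/-! ### Descent along the Cousin complex. -/

section Annihilation

variable {R : Type u} [CommRing R] [IsNoetherianRing R]

/-- A maximal ideal contained in some `p ∈ ∂F n` would equal `p`, which `m ∈ F (n + 1)` excludes. So
`m` has an element outside `p`, invertible on the localization at `p`. -/
lemma Stage.annihilatesLimitExt_nextTerm {𝓕 : SpecFiltration R} {n : ℕ} (S : Stage 𝓕 n)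
    {m : PrimeSpectrum R} (hm : m.asIdeal.IsMaximal) (hmn : m ∈ 𝓕.F (n + 1)) (i : ℕ) (y : R) :
    AnnihilatesLimitExt m.asIdeal i (ModuleCat.of R S.NextTerm) y := by
  refine annihilatesLimitExt_directSum _ m.asIdeal i y fun p => ?_
  have hne : ¬ m.asIdeal ≤ p.1.asIdeal := fun h => by
    have h1 : m = p.1 := PrimeSpectrum.ext (hm.eq_of_le p.1.2.ne_top h)
    exact p.2.2 (h1 ▸ hmn)
  obtain ⟨a, ha, hap⟩ := Set.not_subset.1 hne
  exact ⟨a, ha, IsLocalizedModule.map_units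
    (LocalizedModule.mkLinearMap p.1.asIdeal.primeCompl (S.T ⧸ S.D))
    (⟨a, hap⟩ : p.1.asIdeal.primeCompl)⟩

variable {𝓕 : SpecFiltration R} (M : Type u) [AddCommGroup M] [Module R M] (h𝓕 : 𝓕.Admits M)

lemma cousinStage_D_le_ker (n : ℕ) : (cousinStage M h𝓕 n).D ≤ LinearMap.ker (cousinD M h𝓕 n) := by
  cases n with
  | zero => exact bot_le
  | succ n =>
    rw [cousinStage_succ_D, LinearMap.range_le_ker_iff]
    exact cousinD_comp_cousinD M h𝓕 n

variable {M h𝓕}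

/-- If `x` annihilates the cohomology of the Cousin complex then `x ^ i` annihilates the `i`-th
local cohomology of the module of coboundaries in the term `Mⁿ`. -/
lemma annihilatesLimitExt_cousinStage_D {m : PrimeSpectrum R} (hm : m.asIdeal.IsMaximal) {x : R}
    (hx : ∀ n, x ∈ Module.annihilator R (CousinCohomology M h𝓕 n)) (i n : ℕ)
    (hmn : m ∈ 𝓕.F (n + i + 1)) :
    AnnihilatesLimitExt m.asIdeal i (ModuleCat.of R (cousinStage M h𝓕 (n + 1)).D) (x ^ i) := by
  have hF : m ∈ 𝓕.F (n + 1) :=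
    antitone_nat_of_succ_le 𝓕.succ_subset (show n + 1 ≤ n + i + 1 by omega) hmn
  have hT (j : ℕ) (y : R) :
      AnnihilatesLimitExt m.asIdeal j (ModuleCat.of R (CousinTerm M h𝓕 (n + 1))) y :=
    (cousinStage M h𝓕 n).annihilatesLimitExt_nextTerm hm hF j y
  induction i generalizing n with
  | zero =>
    -- Degree 0 is left exact, so the vanishing for the term passes to its submodule.
    have : Mono (ModuleCat.ofHom (cousinStage M h𝓕 (n + 1)).D.subtype) :=
      (ModuleCat.mono_iff_injective _).2 (Submodule.injective_subtype _)
    exact (hT 0 _).of_mono (ModuleCat.ofHom (cousinStage M h𝓕 (n + 1)).D.subtype)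
  | succ i ih =>
    have hmn' : m ∈ 𝓕.F (n + 1 + i + 1) := by
      rwa [show n + 1 + i + 1 = n + (i + 1) + 1 by omega]
    have hF' : m ∈ 𝓕.F (n + 1 + 1) :=
      antitone_nat_of_succ_le 𝓕.succ_subset (show n + 1 + 1 ≤ n + 1 + i + 1 by omega) hmn'
    have h1 := ih (n + 1) hmn' hF' fun j y =>
      (cousinStage M h𝓕 (n + 1)).annihilatesLimitExt_nextTerm hm hF' j y
    -- The kernel inherits `x ^ i` from the next coboundaries, as the term contributes nothing.
    have hK := h1.left_succ (LinearMap.ker (cousinD M h𝓕 (n + 1))).injective_subtype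
      (cousinD M h𝓕 (n + 1)).exact_subtype_ker_rangeRestrict
      (LinearMap.surjective_rangeRestrict _) (hT (i + 1) 1)
    have hle := cousinStage_D_le_ker M h𝓕 (n + 1)
    have hex : Function.Exact (Submodule.inclusion hle) (Submodule.mkQ
        ((cousinStage M h𝓕 (n + 1)).D.submoduleOf (LinearMap.ker (cousinD M h𝓕 (n + 1))))) := by
      rw [LinearMap.exact_iff, Submodule.ker_mkQ, Submodule.range_inclusion]
      rfl
    have hH := annihilatesLimitExt_of_forall_smul_eq_zero m.asIdeal i
      (N := ModuleCat.of R (CousinCohomology M h𝓕 (n + 1))) (Module.mem_annihilator.1 (hx (n + 1)))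
    -- The extra factor `x` comes from the cohomology module, the quotient of kernel by
    -- coboundaries.
    rw [pow_succ', ← mul_one (x ^ i)]
    exact hH.left_succ (Submodule.inclusion_injective hle) hex (Submodule.mkQ_surjective _) hK

/-- If `x` annihilates the cohomology of the Cousin complex of `M` then `x ^ (i + 1)` annihilates
the `i`-th local cohomology of `M` at the maximal ideals of the `(i + 1)`-st term of the
filtration. -/
lemma annihilatesLimitExt_of_cousinCohomology {m : PrimeSpectrum R} (hm : m.asIdeal.IsMaximal)
    {x : R} (hx : ∀ n, x ∈ Module.annihilator R (CousinCohomology M h𝓕 n)) (i : ℕ)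
    (hmi : m ∈ 𝓕.F (i + 1)) :
    AnnihilatesLimitExt m.asIdeal i (ModuleCat.of R M) (x ^ (i + 1)) := by
  have h1 := annihilatesLimitExt_cousinStage_D hm hx i 0 (by rwa [zero_add])
  let f : M →ₗ[R] CousinTerm M h𝓕 1 := cousinD M h𝓕 0
  have h0 : ∀ a : LinearMap.ker f, x • a = 0 := fun a => by
    have h2 := Module.mem_annihilator.1 (hx 0) (Submodule.Quotient.mk a)
    have h3 : x • a ∈ (⊥ : Submodule R M).submoduleOf (LinearMap.ker f) :=
      (Submodule.Quotient.mk_eq_zero _).1 h2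
    exact Subtype.ext ((Submodule.mem_bot R).1 h3)
  rw [pow_succ']
  exact (annihilatesLimitExt_of_forall_smul_eq_zero m.asIdeal i
    (N := ModuleCat.of R (LinearMap.ker f)) h0).middle (LinearMap.ker f).injective_subtype
    f.exact_subtype_ker_rangeRestrict (LinearMap.surjective_rangeRestrict _) h1

end Annihilation
end CousinComplexes

namespace CousinComplexes

/-! ### Supports of the cohomology modules and the choice of `x`. -/

section Annihilator

variable {R : Type u} [CommRing R]

/-- The cohomology of index `n` of the Cousin complex is supported in `F (n + 1)`. -/
lemma support_cousinCohomology_subset [IsNoetherianRing R] {𝓕 : SpecFiltration R} (M : Type u)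
    [AddCommGroup M] [Module R M] (h𝓕 : 𝓕.Admits M) (n : ℕ) :
    Module.support R (CousinCohomology M h𝓕 n) ⊆ 𝓕.F (n + 1) := by
  intro p hp
  by_contra hpF
  refine Module.notMem_support_iff'.2 (fun c => ?_) hp
  obtain ⟨⟨a, ha⟩, rfl⟩ := Submodule.mkQ_surjective _ c
  suffices h : ∃ r ∉ p.asIdeal, r • (cousinStage M h𝓕 n).D.mkQ a = 0 by
    obtain ⟨r, hr, hra⟩ := h
    refine ⟨r, hr, ?_⟩
    rw [← map_smul] at hra ⊢
    have hmem : r • a ∈ (cousinStage M h𝓕 n).D := (Submodule.Quotient.mk_eq_zero _).1 hra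
    exact (Submodule.Quotient.mk_eq_zero _).2 hmem
  -- On `∂F n` the `p`-component of `d a = 0` is the class of `a` in the localized cokernel; outside
  -- `F n` the cokernel already localizes to zero.
  by_cases hpn : p ∈ 𝓕.F n
  · have hd : (cousinStage M h𝓕 n).d a = 0 := LinearMap.mem_ker.1 ha
    have h0 : (cousinStage M h𝓕 n).d a ⟨p, hpn, hpF⟩ = 0 := by
      rw [hd]
      rfl
    rw [Stage.d_apply, IsLocalizedModule.eq_zero_iff p.asIdeal.primeCompl] at h0
    obtain ⟨r, hr⟩ := h0
    exact ⟨r, r.2, hr⟩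
  · have h1 := fun h => hpn ((cousinStage M h𝓕 n).support_subset h)
    exact Module.notMem_support_iff'.1 h1 _

variable (M : Type u) [AddCommGroup M] [Module R M]

lemma moduleHeight_eq_zero_of_mem_minPrimes {p : PrimeSpectrum R} (hp : p ∈ minPrimes R M) :
    moduleHeight M p = 0 := by
  rw [moduleHeight_eq_height M hp.1]
  have h : Order.height (⟨p, hp.1⟩ : Module.support R M) = 0 :=
    Order.height_eq_zero.2 fun q hq => hp.2 q.2 hq
  rw [h]
  rfl

lemma moduleHeight_le_supportDim (p : PrimeSpectrum R) :
    moduleHeight M p ≤ Module.supportDim R M := by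
  by_cases hp : p ∈ Module.support R M
  · rw [moduleHeight_eq_height M hp]
    exact Order.height_le_krullDim _
  · have h : moduleHeight M p = ⊥ := by
      rw [moduleHeight, Module.supportDim_eq_bot_iff_subsingleton]
      exact Module.notMem_support_iff.1 hp
    rw [h]
    exact bot_le

variable [IsNoetherianRing R]

lemma annihilator_heightCousinCohomology_eq_top {d n : ℕ} (hd : Module.supportDim R M = d)
    (hn : d ≤ n) : Module.annihilator R (HeightCousinCohomology R M n) = ⊤ := by
  rw [Module.annihilator_eq_top_iff, ← Module.support_eq_empty_iff (R := R),
    Set.eq_empty_iff_forall_notMem]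
  intro p hp
  have h1 := (support_cousinCohomology_subset M (heightFiltration_admits R M) n hp).2.trans
    ((moduleHeight_le_supportDim M p).trans hd.le)
  have h2 : n + 1 ≤ d := by exact_mod_cast h1
  omega

variable {M}

lemma finite_minPrimes [Module.Finite R M] : (minPrimes R M).Finite := by
  have hfin := (Module.annihilator R M).finite_minimalPrimes_of_isNoetherianRing R
  refine Set.Finite.of_finite_image (f := PrimeSpectrum.asIdeal) (hfin.subset ?_)
    fun p _ q _ h => PrimeSpectrum.ext h
  rintro _ ⟨p, hp, rfl⟩
  have hsupp (q : PrimeSpectrum R) :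
      q ∈ Module.support R M ↔ Module.annihilator R M ≤ q.asIdeal := by
    rw [Module.support_eq_zeroLocus]
    rfl
  exact ⟨⟨p.2, (hsupp p).1 hp.1⟩, fun Q hQ hQp => hp.2 (y := ⟨Q, hQ.1⟩) ((hsupp _).2 hQ.2) hQp⟩

/-- If the Cousin complex of `M` is finite, its cohomology is annihilated by an element outside all
minimal primes of `M`. -/
lemma exists_mem_annihilator_heightCousinCohomology [Module.Finite R M]
    (hfin : IsCousinFinite R M) {d : ℕ} (hd : Module.supportDim R M = d) :
    ∃ x : R, (∀ n : ℕ, x ∈ Module.annihilator R (HeightCousinCohomology R M n)) ∧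
      ∀ p ∈ minPrimes R M, x ∉ p.asIdeal := by
  -- The factors with `n ≥ d` would be the unit ideal, so a finite product suffices.
  let A := ∏ n ∈ Finset.range d, Module.annihilator R (HeightCousinCohomology R M n)
  have hA : ∀ p ∈ minPrimes R M, ¬ A ≤ p.asIdeal := by
    intro p hp hle
    obtain ⟨n, -, hn⟩ := (p.2.prod_le).1 hle
    have := hfin n
    -- Finite generation enters here: the support is the whole zero locus of the annihilator.
    have hps : p ∈ Module.support R (HeightCousinCohomology R M n) := by
      rw [Module.support_eq_zeroLocus]
      exact hn
    have h1 := (support_cousinCohomology_subset M (heightFiltration_admits R M) n hps).2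
    rw [moduleHeight_eq_zero_of_mem_minPrimes M hp] at h1
    have h2 : n + 1 ≤ 0 := by exact_mod_cast h1
    omega
  -- Prime avoidance over the finitely many minimal primes.
  have hnot : ¬ (A : Set R) ⊆ ⋃ p ∈ ((finite_minPrimes (R := R) (M := M)).toFinset :
      Set (PrimeSpectrum R)), (p.asIdeal : Set R) := fun h => by
    obtain ⟨p₀, -⟩ := Set.mem_iUnion.1 (h A.zero_mem)
    obtain ⟨p, hp, hle⟩ := (Ideal.subset_union_prime (f := PrimeSpectrum.asIdeal) p₀ p₀
      fun p _ _ _ => p.2).1 h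
    exact hA p ((Set.Finite.mem_toFinset _).1 hp) hle
  obtain ⟨x, hxA, hx⟩ := Set.not_subset.1 hnot
  refine ⟨x, fun n => ?_, fun p hp hxp => hx ?_⟩
  · by_cases hn : n < d
    · exact Ideal.prod_le_inf.trans (Finset.inf_le (Finset.mem_range.2 hn)) hxA
    · rw [annihilator_heightCousinCohomology_eq_top M hd (not_lt.1 hn)]
      trivial
  · exact Set.mem_biUnion ((Set.Finite.mem_toFinset _).2 hp) hxp

lemma isUniformLocalCohomologicalAnnihilator_pow {d : ℕ} (hd : Module.supportDim R M = d) {x : R}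
    (hx : ∀ n : ℕ, x ∈ Module.annihilator R (HeightCousinCohomology R M n))
    (hxp : ∀ p ∈ minPrimes R M, x ∉ p.asIdeal) :
    IsUniformLocalCohomologicalAnnihilator M (x ^ d) := by
  refine ⟨fun p hp h => hxp p hp (p.2.mem_of_pow_mem d h), fun m hm i hi h => ?_⟩
  have hms : m ∈ Module.support R M := by
    by_contra hms
    have h0 : moduleHeight M m = ⊥ := by
      rw [moduleHeight, Module.supportDim_eq_bot_iff_subsingleton]
      exact Module.notMem_support_iff.1 hms
    exact not_lt_bot (h0 ▸ hi)
  have hi' : ((i + 1 : ℕ) : WithBot ℕ∞) ≤ moduleHeight M m := by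
    rw [moduleHeight_eq_height M hms] at hi ⊢
    have h1 : (i : ℕ∞) < Order.height (⟨m, hms⟩ : Module.support R M) := by exact_mod_cast hi
    exact_mod_cast Order.add_one_le_of_lt h1
  -- This bounds the exponent `i + 1` by `d`, uniformly in `m` and `i`.
  have hid : i + 1 ≤ d := by
    exact_mod_cast hi'.trans ((moduleHeight_le_supportDim M m).trans hd.le)
  exact ((annihilatesLimitExt_of_cousinCohomology hm hx i ⟨hms, hi'⟩).dvd
    (pow_dvd_pow x hid)).smul_localCohomology_eq_zero h

end Annihilator

end CousinComplexes

open CousinComplexes in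
theorem theorem2p2p11 {R : Type u} [CommRing R] [IsNoetherianRing R]
    (M : Type u) [AddCommGroup M] [Module R M] [Module.Finite R M]
    (hdim : Module.supportDim R M < ⊤) (hfin : IsCousinFinite R M) :
    (∃ x : R, IsUniformLocalCohomologicalAnnihilator M x) ∧
      ∀ d : ℕ, Module.supportDim R M = d →
        ∀ x : R, (∀ n : ℕ, x ∈ Module.annihilator R (HeightCousinCohomology R M n)) →
          (∀ p ∈ minPrimes R M, x ∉ p.asIdeal) →
            IsUniformLocalCohomologicalAnnihilator M (x ^ d) := by
  refine ⟨?_, fun d hd x hx hxp => isUniformLocalCohomologicalAnnihilator_pow hd hx hxp⟩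
  rcases subsingleton_or_nontrivial M with hM | hM
  · have hbot (m : PrimeSpectrum R) : m ∉ Module.support R M := by
      simp [Module.support_eq_empty]
    -- For `M = 0` every height is `⊥`, so no degree `i` has to be checked.
    refine ⟨1, fun p hp => (hbot p hp.1).elim, fun m _ i hi => ?_⟩
    have h0 := (Module.supportDim_eq_bot_of_subsingleton R M ▸ moduleHeight_le_supportDim M m)
    exact (not_lt_bot (hi.trans_le h0)).elim
  · obtain ⟨d, hd⟩ : ∃ d : ℕ, Module.supportDim R M = d := by
      obtain ⟨e, he⟩ := WithBot.ne_bot_iff_exists.1 (Module.supportDim_ne_bot_of_nontrivial R M)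
      rw [← he] at hdim ⊢
      have he' : e ≠ ⊤ := fun h => by simp [h] at hdim
      obtain ⟨d, rfl⟩ := ENat.ne_top_iff_exists.1 he'
      exact ⟨d, rfl⟩
    obtain ⟨x, hx, hxp⟩ := exists_mem_annihilator_heightCousinCohomology hfin hd
    exact ⟨x ^ d, isUniformLocalCohomologicalAnnihilator_pow hd hx hxp⟩
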